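/- Let $A$ be a finite alphabet. Formulas of $\mathrm{FO}(A,\min,\max,N)$ are the first-order formulas (with equality) built from the constants $\min,\max$, the unary predicates $P_a$ ($a\in A$) and the binary predicate $N$. In a nonempty finite word $w$ over $A$ variables range over the positions of $w$, $\min$ and $\max$ denote the first and the last position, $P_a(x)$ says that position $x$ carries the letter $a$, and $N(x,y)$ says that $x+1=y$ or $y+1=x$. For a sentence $\varphi$ let $L(\varphi)\subseteq A^+$ be the set of nonempty words that satisfy $\varphi$. A language $L\subseteq A^*$ is \emph{definable in $\mathrm{FO}(A,\min,\max,N)$} if $L\setminus\{\varepsilon\}=L(\varphi)$ for some sentence $\varphi$ (the empty word is disregarded because $\min$ and $\max$ have no meaning in it; for $L\subseteq A^+$ the condition is $L=L(\varphi)$). For $t>0$ and $i,j\in\mathbb N$ write $i=^t j$ if either $i<t$ and $i=j$, or $i\ge t$ and $j\ge t$. Let $v^r$ be the reverse of a word $v$, and let $\sharp^r(w,v)$ be the number of pairs $(x,y)\in A^*\times A^*$ such that $w=xvy$ or $w=xv^ry$. For $k,t>0$, two words $w,w'\in A^*$ are \emph{equivalent} with respect to $(k,t)$ if either $|w|<k$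 and $w=w'$, or both have length at least $k$ and they have the same prefix of length $k-1$, the same suffix of length $k-1$, and $\sharp^r(w,v)=^t\sharp^r(w',v)$ for each $v\in A^+$ of length at most $k$. A language $L\subseteq A^*$ is \emph{weakly locally-reversible threshold testable} if, for some $k,t>0$, it is a union of classes of this equivalence relation. \textbf{Theorem.} A language $L\subseteq A^*$ is definable in $\mathrm{FO}(A,\min,\max,N)$ if and only if it is weakly locally-reversible threshold testable. -/

import Mathlib

namespace NeighbourLogic

universe u

/-! First-order logic over finite words with the endpoint constants and the neighbour relation. -/

/-- The two constants: the first and the last position of a word. -/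
inductive ConstSymb : ℕ → Type u
  | minPos : ConstSymb 0
  | maxPos : ConstSymb 0

/-- The letter predicates `P_a` and the neighbour predicate `N`. Equality is part of the logic. -/
inductive RelSymb (A : Type u) : ℕ → Type u
  | letter (a : A) : RelSymb A 1
  | neighbour : RelSymb A 2

/-- The signature of `FO(A, min, max, N)`. -/
def signature (A : Type u) : FirstOrder.Language.{u, u} where
  Functions := ConstSymb
  Relations := RelSymb A

/-- A nonempty word as a structure whose elements are its positions. -/
@[reducible] def wordStructure {A : Type u} (w : List A) (hw : w ≠ []) :
    (signature A).Structure (Fin w.length) where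
  funMap := fun f _ =>
    match f with
    | ConstSymb.minPos => ⟨0, List.length_pos_of_ne_nil hw⟩
    | ConstSymb.maxPos => ⟨w.length - 1, Nat.sub_one_lt (List.length_pos_of_ne_nil hw).ne'⟩
  RelMap := fun r x =>
    match r, x with
    | RelSymb.letter a, x => w.get (x 0) = a
    | RelSymb.neighbour, x =>
        (x 0 : ℕ) + 1 = (x 1 : ℕ) ∨ (x 1 : ℕ) + 1 = (x 0 : ℕ)

/-- The nonempty word `w` satisfies the sentence `φ`. -/
def Satisfies {A : Type u} (w : List A) (hw : w ≠ []) (φ : (signature A).Sentence) : Prop :=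
  letI := wordStructure w hw
  φ.Realize (Fin w.length)

/-- `L(φ)`, the set of (nonempty) words satisfying `φ`. The constants have no
interpretation in the empty word. -/
def definedLanguage {A : Type u} (φ : (signature A).Sentence) : Set (List A) :=
  {w | ∃ hw : w ≠ [], Satisfies w hw φ}

/-- `L` is definable in `FO(A, min, max, N)`: its nonempty words are exactly the
words satisfying some sentence. If `L` does not contain the empty word, this says `L(φ) = L`. -/
def IsDefinable {A : Type u} (L : Language A) : Prop :=
  ∃ φ : (signature A).Sentence, definedLanguage φ = {w | w ∈ L ∧ w ≠ []}

/-! Weakly locally-reversible threshold testable languages. -/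

/-- Equality of natural numbers with threshold `t`. -/
def ThresholdEq (t i j : ℕ) : Prop :=
  if i < t then i = j else t ≤ i ∧ t ≤ j

/-- The number of occurrences of `v` or its reverse in `w`: the number of pairs `(x, y)` with
`w = x v y` or `w = x vʳ y`. -/
noncomputable def revCount {A : Type u} (w v : List A) : ℕ :=
  {p : List A × List A | w = p.1 ++ v ++ p.2 ∨ w = p.1 ++ v.reverse ++ p.2}.ncard

/-- Words `w`, `w'` are equivalent if `|w| < k` and `w = w'`, or both have length at least `k`, the
same prefix and the same suffix of length `k - 1`, and the same number of occurrences up to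
reversal and up to threshold `t` of every nonempty word of length at most `k`. -/
def RevEquiv {A : Type u} (k t : ℕ) (w w' : List A) : Prop :=
  (w.length < k ∧ w = w') ∨
  (k ≤ w.length ∧ k ≤ w'.length ∧
    w.take (k - 1) = w'.take (k - 1) ∧
    w.rtake (k - 1) = w'.rtake (k - 1) ∧
    ∀ v : List A, v ≠ [] → v.length ≤ k → ThresholdEq t (revCount w v) (revCount w' v))

theorem thresholdEq_iff (t i j : ℕ) : ThresholdEq t i j ↔ min t i = min t j := by
  unfold ThresholdEq
  split <;> omega

/-- The equivalence above, bundled with the proof that it is an equivalence relation. -/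
def revSetoid (A : Type u) (k t : ℕ) : Setoid (List A) where
  r := RevEquiv k t
  iseqv := by
    refine ⟨fun w => ?_, fun {w w'} h => ?_, fun {w w' w''} h h' => ?_⟩
    · rcases lt_or_ge w.length k with h | h
      · exact Or.inl ⟨h, rfl⟩
      · exact Or.inr ⟨h, h, rfl, rfl, fun v _ _ => (thresholdEq_iff _ _ _).2 rfl⟩
    · rcases h with ⟨h, rfl⟩ | ⟨h1, h2, h3, h4, h5⟩
      · exact Or.inl ⟨h, rfl⟩
      · exact Or.inr ⟨h2, h1, h3.symm, h4.symm, fun v hv hk =>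
          (thresholdEq_iff _ _ _).2 ((thresholdEq_iff _ _ _).1 (h5 v hv hk)).symm⟩
    · rcases h with ⟨h, rfl⟩ | ⟨h1, h2, h3, h4, h5⟩
      · exact h'
      · rcases h' with ⟨h, rfl⟩ | ⟨g1, g2, g3, g4, g5⟩
        · exact Or.inr ⟨h1, h2, h3, h4, h5⟩
        · exact Or.inr ⟨h1, g2, h3.trans g3, h4.trans g4, fun v hv hk =>
            (thresholdEq_iff _ _ _).2 (((thresholdEq_iff _ _ _).1 (h5 v hv hk)).trans
              ((thresholdEq_iff _ _ _).1 (g5 v hv hk)))⟩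

/-- `L` is weakly locally-reversible threshold testable: for some `k, t > 0` it is a union of
equivalence classes. -/
def IsWeaklyLRTT {A : Type u} (L : Language A) : Prop :=
  ∃ k t : ℕ, 0 < k ∧ 0 < t ∧
    ∃ C : Set (Set (List A)), C ⊆ (revSetoid A k t).classes ∧ {w | w ∈ L} = ⋃₀ C

end NeighbourLogic

namespace NeighbourLogic

/-! From definability to testability the argument is an Ehrenfeucht–Fraïssé game. Since `N` is
symmetric, a ball around a position is known only up to orientation, so a position of the game is a
finite set of pairs of points whose balls correspond by translations or reflections that agree where
balls meet (`IsMatching`). Each quantifier divides the radius by three. A new point near a matched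
one has its image forced (`IsMatching.insert_of_near`). For a far point
`IsMatching.exists_far_similarPoint` counts: if all candidate answers were near matched points, the
local maps would carry them back injectively to points of the same type other than the new one, so
the second word would have strictly fewer of them, and too few for the threshold to hide the
difference. The two ends are matched from the start, so a far point has its ball inside the word and
the ball is a factor, whose occurrences up to reversal are counted. `realizeIn_congr` runs the
induction on formulas.

Conversely, over a finite alphabet a class is determined by finitely many conditions on length,
prefix, suffix and counts. Each is first-order because an injective walk along `N` cannot turn round
(`eq_add_or_add_eq_of_injOn`): reading `v` along it gives an occurrence of `v` or of its reverse,
and `min` or `max` fixes the direction at the ends. -/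

/-! Occurrences of factors. -/

/-- The letter of `w` at an integer position, `none` outside the word. -/
def letterAt {A : Type*} (w : List A) (z : ℤ) : Option A :=
  if 0 ≤ z then w[z.toNat]? else none

theorem letterAt_natCast {A : Type*} (w : List A) (n : ℕ) : letterAt w n = w[n]? := by
  simp [letterAt]

theorem letterAt_eq_none_iff {A : Type*} {w : List A} {z : ℤ} :
    letterAt w z = none ↔ z < 0 ∨ w.length ≤ z := by
  unfold letterAt
  split
  · rw [List.getElem?_eq_none_iff]; omega
  · simp; omega

/-- The word `v` is read in `w` from position `m` on. -/
def OccursAt {A : Type*} (w v : List A) (m : ℕ) : Prop :=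
  ∀ j < v.length, w[m + j]? = v[j]?

/-- The positions of `w` at which a factor equal to `v` or to its reverse starts. -/
def occurrences {A : Type*} (w v : List A) : Set ℕ :=
  {m | OccursAt w v m ∨ OccursAt w v.reverse m}

theorem occursAt_iff_exists_append {A : Type*} {w v : List A} {m : ℕ} (hv : v ≠ []) :
    OccursAt w v m ↔ ∃ x y, w = x ++ v ++ y ∧ x.length = m := by
  have hl := List.length_pos_of_ne_nil hv
  constructor
  · intro h
    have hpre : v <+: w.drop m := by
      rw [List.prefix_iff_getElem?]
      intro i hi
      rw [List.getElem?_drop, h i hi, List.getElem?_eq_getElem hi]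
    obtain ⟨y, hy⟩ := hpre
    have hm : m < w.length := by
      have h0 := h 0 hl
      rw [List.getElem?_eq_getElem hl] at h0
      exact (List.getElem?_eq_some_iff.1 h0).1
    refine ⟨w.take m, y, ?_, by simp; omega⟩
    rw [List.append_assoc, hy, List.take_append_drop]
  · rintro ⟨x, y, rfl, rfl⟩ j hj
    rw [List.append_assoc, List.getElem?_append_right (by omega),
      List.getElem?_append_left (by omega)]
    congr 1; omega

theorem OccursAt.add_length_le {A : Type*} {w v : List A} {m : ℕ} (hv : v ≠ [])
    (h : OccursAt w v m) : m + v.length ≤ w.length := by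
  obtain ⟨x, y, rfl, rfl⟩ := (occursAt_iff_exists_append hv).1 h
  simp

theorem occurrences_finite {A : Type*} (w : List A) {v : List A} (hv : v ≠ []) :
    (occurrences w v).Finite := by
  refine (Set.finite_le_nat w.length).subset ?_
  rintro m (h | h)
  · have := h.add_length_le hv; simp; omega
  · have := h.add_length_le (by simpa using hv); simp; omega

/-- A word and its reverse have equal length, so a factorisation is recovered from the length of its
left part alone. Where `v` and its reverse coincide, the occurrence is counted once on both sides.
-/
theorem revCount_eq_ncard_occurrences {A : Type*} (w : List A) {v : List A} (hv : v ≠ []) :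
    revCount w v = (occurrences w v).ncard := by
  have hv' : v.reverse ≠ [] := by simpa using hv
  have himage : occurrences w v = (fun p : List A × List A => p.1.length) ''
      {p | w = p.1 ++ v ++ p.2 ∨ w = p.1 ++ v.reverse ++ p.2} := by
    ext m
    simp only [occurrences, Set.mem_ofPred_eq, Set.mem_image, Prod.exists,
      occursAt_iff_exists_append hv, occursAt_iff_exists_append hv', or_and_right, exists_or]
  rw [himage, Set.InjOn.ncard_image, revCount]
  have key : ∀ p : List A × List A, (w = p.1 ++ v ++ p.2 ∨ w = p.1 ++ v.reverse ++ p.2) →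
      p = (w.take p.1.length, w.drop (p.1.length + v.length)) := by
    rintro ⟨x, y⟩ (h | h)
    all_goals
      subst h
      simp [← List.drop_drop]
  intro p hp q hq hpq
  rw [key p hp, key q hq]
  simp only at hpq
  rw [hpq]

/-! Comparison of balls in two coloured lines. -/

/-- The points of `g` whose ball of radius `r` is, up to orientation, that of `x` in `f`. -/
def similarPoints {B : Type*} (f g : ℤ → B) (r : ℕ) (x : ℤ) : Set ℤ :=
  {z | ∃ ε : ℤ, (ε = 1 ∨ ε = -1) ∧ ∀ d : ℤ, |d| ≤ r → f (x + d) = g (z + ε * d)}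

theorem similarPoints_letterAt_finite {A : Type*} {f : ℤ → Option A} (w : List A) (r : ℕ) {x : ℤ}
    (hx : f x ≠ none) : (similarPoints f (letterAt w) r x).Finite := by
  refine (Set.finite_Icc (0 : ℤ) w.length).subset ?_
  rintro z ⟨ε, -, h⟩
  have h0 := h 0 (by simp)
  rw [mul_zero, add_zero, add_zero] at h0
  rw [h0, Ne, letterAt_eq_none_iff] at hx
  simp only [Set.mem_Icc]; omega

theorem similarPoints_eq_image_occurrences {A : Type*} {f : ℤ → Option A} {r : ℕ} {x : ℤ}
    {v : List A} (hv : v.length = 2 * r + 1)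
    (hfv : ∀ j < v.length, f (x - r + j) = v[j]?) (w : List A) :
    similarPoints f (letterAt w) r x = (fun m : ℕ => (m : ℤ) + r) '' occurrences w v := by
  have hsome : ∀ j < v.length, v[j]? ≠ none := by
    intro j hj; simpa using hj
  ext z
  constructor
  · rintro ⟨ε, hε, h⟩
    have hget : ∀ j < v.length, letterAt w (z + ε * (j - r)) = v[j]? := by
      intro j hj
      rw [← hfv j hj, ← h _ (by rw [abs_le]; omega)]
      congr 1; ring
    -- Both extreme points of the ball carry letters, so the ball lies inside `w` and `toNat` loses
    -- nothing.
    have hz : ((z - r).toNat : ℤ) = z - r := by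
      have h0 := hget 0 (by omega)
      have h1 := hget (2 * r) (by omega)
      have g0 := hsome 0 (by omega)
      have g1 := hsome (2 * r) (by omega)
      rw [← h0, Ne, letterAt_eq_none_iff] at g0
      rw [← h1, Ne, letterAt_eq_none_iff] at g1
      rcases hε with rfl | rfl <;> push_cast at * <;> omega
    refine ⟨(z - r).toNat, ?_, by simp only; omega⟩
    rcases hε with rfl | rfl
    · left
      intro j hj
      rw [← hget j hj, ← letterAt_natCast]
      congr 1; push_cast; rw [hz]; ring
    · right
      intro j hj
      rw [List.length_reverse] at hj
      rw [List.getElem?_reverse hj, ← hget _ (by omega), ← letterAt_natCast]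
      congr 1; omega
  · rintro ⟨m, h, rfl⟩
    beta_reduce
    rcases h with h | h
    · refine ⟨1, Or.inl rfl, fun d hd => ?_⟩
      rw [abs_le] at hd
      have := h (d + r).toNat (by omega)
      rw [← hfv _ (by omega), ← letterAt_natCast] at this
      convert this.symm using 2 <;> omega
    · refine ⟨-1, Or.inr rfl, fun d hd => ?_⟩
      rw [abs_le] at hd
      have := h (r - d).toNat (by rw [List.length_reverse]; omega)
      rw [List.getElem?_reverse (by omega), ← hfv _ (by omega), ← letterAt_natCast] at this
      convert this.symm using 2 <;> omega

theorem exists_factor_ncard_similarPoints {A : Type*} (w : List A) (r : ℕ) {x : ℤ}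
    (h1 : r ≤ x) (h2 : x + r < w.length) : ∃ v : List A, v.length = 2 * r + 1 ∧
      ∀ w' : List A, (similarPoints (letterAt w) (letterAt w') r x).ncard =
        (occurrences w' v).ncard := by
  have hlen : ((w.drop (x - r).toNat).take (2 * r + 1)).length = 2 * r + 1 := by
    simp; omega
  refine ⟨_, hlen, fun w' => ?_⟩
  rw [similarPoints_eq_image_occurrences hlen, Set.ncard_image_of_injective]
  · intro a b h; simpa using h
  · intro j hj
    rw [hlen] at hj
    rw [List.getElem?_take_of_lt hj, List.getElem?_drop, ← letterAt_natCast]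
    congr 1; omega

/-- A set of triples `(a, b, ε)`, each saying that the ball of radius `r` around `a` in `f` is
carried to the one around `b` in `g` by a translation (`ε = 1`) or a reflection (`ε = -1`);
these maps agree wherever two balls meet. -/
structure IsMatching {B : Type*} (f g : ℤ → B) (r : ℕ) (S : Finset (ℤ × ℤ × ℤ)) : Prop where
  sign : ∀ a b ε, (a, b, ε) ∈ S → ε = 1 ∨ ε = -1
  ball : ∀ a b ε, (a, b, ε) ∈ S → ∀ d : ℤ, |d| ≤ r → f (a + d) = g (b + ε * d)
  compat : ∀ a b ε a' b' ε', (a, b, ε) ∈ S → (a', b', ε') ∈ S →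
    (|a - a'| ≤ 2 * r ∨ |b - b'| ≤ 2 * r) → ε = ε' ∧ b' - b = ε * (a' - a)

/-- Exchange the two sides of a matching. -/
def swapTriples (S : Finset (ℤ × ℤ × ℤ)) : Finset (ℤ × ℤ × ℤ) :=
  S.image fun p => (p.2.1, p.1, p.2.2)

theorem mem_swapTriples {S : Finset (ℤ × ℤ × ℤ)} {a b ε : ℤ} :
    (a, b, ε) ∈ swapTriples S ↔ (b, a, ε) ∈ S := by
  simp only [swapTriples, Finset.mem_image, Prod.exists, Prod.mk.injEq]
  constructor
  · rintro ⟨a', b', ε', h, rfl, rfl, rfl⟩; exact h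
  · exact fun h => ⟨b, a, ε, h, rfl, rfl, rfl⟩

theorem IsMatching.swap {B : Type*} {f g : ℤ → B} {r : ℕ} {S : Finset (ℤ × ℤ × ℤ)}
    (h : IsMatching f g r S) : IsMatching g f r (swapTriples S) where
  sign a b ε hp := h.sign _ _ _ (mem_swapTriples.1 hp)
  ball a b ε hp d hd := by
    have hp := mem_swapTriples.1 hp
    rcases h.sign _ _ _ hp with rfl | rfl
    · rw [h.ball _ _ _ hp _ (by simpa using hd)]
      congr 1; ring
    · rw [h.ball _ _ _ hp _ (by simpa using hd)]
      congr 1; ring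
  compat a b ε a' b' ε' hp hq hd := by
    have hp := mem_swapTriples.1 hp
    obtain ⟨h1, h2⟩ := h.compat _ _ _ _ _ _ hp (mem_swapTriples.1 hq) hd.symm
    refine ⟨h1, ?_⟩
    rcases h.sign _ _ _ hp with rfl | rfl <;> linarith

/-! ### Extending a matching by one point. -/

/-- The new point moves with the local map at `a`. The factor 3 makes the `s`-ball around `x` fit in
the `r`-ball around `a`; a centre within `2 * s` of `x` is within `4 * s ≤ 2 * r` of `a`, so the old
compatibility applies. -/
theorem IsMatching.insert_of_near {B : Type*} {f g : ℤ → B} {r s : ℕ} {S : Finset (ℤ × ℤ × ℤ)}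
    (h : IsMatching f g r S) (hs : 3 * s ≤ r) {a b ε x : ℤ} (hp : (a, b, ε) ∈ S)
    (hx : |x - a| ≤ 2 * s) : IsMatching f g s (insert (x, b + ε * (x - a), ε) S) := by
  have hε := h.sign _ _ _ hp
  rw [abs_le] at hx
  have hs' : (3 * s : ℤ) ≤ r := by exact_mod_cast hs
  have key : ∀ a' b' ε', (a', b', ε') ∈ S →
      (|x - a'| ≤ 2 * s ∨ |b + ε * (x - a) - b'| ≤ 2 * s) →
      ε = ε' ∧ b' - (b + ε * (x - a)) = ε * (a' - x) := by
    intro a' b' ε' hq hd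
    obtain ⟨h1, h2⟩ := h.compat _ _ _ _ _ _ hp hq (by
      rcases hd with hd | hd
      · left; rw [abs_le] at hd ⊢; omega
      · right; rw [abs_le] at hd ⊢
        rcases hε with rfl | rfl <;> omega)
    refine ⟨h1, ?_⟩
    linear_combination h2
  constructor
  · intro a' b' ε' hq
    rcases Finset.mem_insert.1 hq with hq | hq
    · simp only [Prod.mk.injEq] at hq
      rw [hq.2.2]; exact hε
    · exact h.sign _ _ _ hq
  · intro a' b' ε' hq d hd
    rw [abs_le] at hd
    rcases Finset.mem_insert.1 hq with hq | hq
    · simp only [Prod.mk.injEq] at hq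
      obtain ⟨rfl, rfl, rfl⟩ := hq
      have := h.ball _ _ _ hp (a' - a + d) (by rw [abs_le]; omega)
      convert this using 2 <;> ring
    · exact h.ball _ _ _ hq d (by rw [abs_le]; omega)
  · intro a₁ b₁ ε₁ a₂ b₂ ε₂ h₁ h₂ hd
    rcases Finset.mem_insert.1 h₁ with k₁ | k₁ <;> rcases Finset.mem_insert.1 h₂ with k₂ | k₂
    · simp only [Prod.mk.injEq] at k₁ k₂
      obtain ⟨rfl, rfl, rfl⟩ := k₁
      obtain ⟨rfl, rfl, rfl⟩ := k₂
      simp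
    · simp only [Prod.mk.injEq] at k₁
      obtain ⟨rfl, rfl, rfl⟩ := k₁
      exact key _ _ _ k₂ hd
    · simp only [Prod.mk.injEq] at k₂
      obtain ⟨rfl, rfl, rfl⟩ := k₂
      obtain ⟨rfl, h4⟩ := key _ _ _ k₁ (by rwa [abs_sub_comm, abs_sub_comm _ b₁])
      exact ⟨rfl, by linear_combination -h4⟩
    · refine h.compat _ _ _ _ _ _ k₁ k₂ ?_
      rcases hd with hd | hd
      · left; omega
      · right; omega

theorem IsMatching.insert_of_far {B : Type*} {f g : ℤ → B} {r s : ℕ} {S : Finset (ℤ × ℤ × ℤ)}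
    (h : IsMatching f g r S) (hs : s ≤ r) {x y ε : ℤ} (hε : ε = 1 ∨ ε = -1)
    (hxy : ∀ d : ℤ, |d| ≤ s → f (x + d) = g (y + ε * d))
    (hx : ∀ a b ε, (a, b, ε) ∈ S → 2 * s < |x - a|)
    (hy : ∀ a b ε, (a, b, ε) ∈ S → 2 * s < |y - b|) :
    IsMatching f g s (insert (x, y, ε) S) := by
  constructor
  · intro a' b' ε' hq
    rcases Finset.mem_insert.1 hq with hq | hq
    · simp only [Prod.mk.injEq] at hq
      rw [hq.2.2]; exact hε
    · exact h.sign _ _ _ hq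
  · intro a' b' ε' hq d hd
    rcases Finset.mem_insert.1 hq with hq | hq
    · simp only [Prod.mk.injEq] at hq
      obtain ⟨rfl, rfl, rfl⟩ := hq
      exact hxy d hd
    · exact h.ball _ _ _ hq d (by omega)
  · intro a₁ b₁ ε₁ a₂ b₂ ε₂ h₁ h₂ hd
    rcases Finset.mem_insert.1 h₁ with k₁ | k₁ <;> rcases Finset.mem_insert.1 h₂ with k₂ | k₂
    · simp only [Prod.mk.injEq] at k₁ k₂
      obtain ⟨rfl, rfl, rfl⟩ := k₁
      obtain ⟨rfl, rfl, rfl⟩ := k₂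
      simp
    · simp only [Prod.mk.injEq] at k₁
      obtain ⟨rfl, rfl, rfl⟩ := k₁
      have := hx _ _ _ k₂
      have := hy _ _ _ k₂
      omega
    · simp only [Prod.mk.injEq] at k₂
      obtain ⟨rfl, rfl, rfl⟩ := k₂
      have := hx _ _ _ k₁
      have := hy _ _ _ k₁
      rw [abs_sub_comm, abs_sub_comm b₁] at hd
      omega
    · refine h.compat _ _ _ _ _ _ k₁ k₂ ?_
      rcases hd with hd | hd
      · left; omega
      · right; omega

/-- If every similar point of `g` is near some `b`, there are at most `S.card * (4 * s + 1) < t` of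
them. The local maps send them back injectively to similar points of `f`, missing `x`, so `f` has
strictly more; truncation at `t` cannot hide this. -/
theorem IsMatching.exists_far_similarPoint {B : Type*} {f g : ℤ → B} {r s t : ℕ}
    {S : Finset (ℤ × ℤ × ℤ)} (h : IsMatching f g r S) (hs : 3 * s ≤ r) {x : ℤ}
    (hx : ∀ a b ε, (a, b, ε) ∈ S → 2 * s < |x - a|) (hfin : (similarPoints f f s x).Finite)
    (hcount : min t (similarPoints f f s x).ncard = min t (similarPoints f g s x).ncard)
    (ht : S.card * (4 * s + 1) < t) :
    ∃ y ∈ similarPoints f g s x, ∀ a b ε, (a, b, ε) ∈ S → 2 * s < |y - b| := by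
  by_contra! hcon
  choose! a b ε hS hnear using hcon
  have hs' : (3 * s : ℤ) ≤ r := by exact_mod_cast hs
  have hle : (similarPoints f g s x).ncard ≤ S.card * (4 * s + 1) := by
    have hsub : similarPoints f g s x ⊆
        (S.biUnion fun p => Finset.Icc (p.2.1 - 2 * s) (p.2.1 + 2 * s) : Finset ℤ) := by
      intro z hz
      have := hnear z hz
      rw [abs_le] at this
      simp only [Finset.coe_biUnion, Set.mem_iUnion, Finset.coe_Icc, Set.mem_Icc]
      exact ⟨_, hS z hz, by simp only; omega, by simp only; omega⟩
    refine (Set.ncard_le_ncard hsub (Finset.finite_toSet _)).trans ?_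
    rw [Set.ncard_coe_finset]
    refine Finset.card_biUnion_le_card_mul _ _ _ fun p _ => ?_
    rw [Int.card_Icc]; omega
  have hself : x ∈ similarPoints f f s x := ⟨1, Or.inl rfl, fun d _ => by rw [one_mul]⟩
  have hlt : (similarPoints f g s x).ncard < (similarPoints f f s x).ncard := by
    refine lt_of_le_of_lt ?_ (Set.ncard_sdiff_singleton_lt_of_mem hself hfin)
    -- The inverse of the local map at `b z`; a sign is its own inverse.
    refine Set.ncard_le_ncard_of_injOn (fun z => a z + ε z * (z - b z)) ?_ ?_ (hfin.sdiff)
    · intro z hz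
      have hb := hnear z hz
      rw [abs_le] at hb
      have hε := h.sign _ _ _ (hS z hz)
      refine ⟨?_, ?_⟩
      · obtain ⟨δ, hδ, hd⟩ := hz
        refine ⟨ε z * δ, ?_, fun d hd' => ?_⟩
        · rcases hε with e | e <;> rcases hδ with e' | e' <;> simp [e, e']
        · have hball := h.ball _ _ _ (hS z ⟨δ, hδ, hd⟩) (ε z * (z - b z) + ε z * δ * d) (by
            rw [abs_le] at hd' ⊢
            rcases hε with e | e <;> rcases hδ with e' | e' <;> rw [e, e'] <;> omega)
          rw [hd d hd', add_assoc, hball]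
          congr 1
          rcases hε with e | e <;> rw [e] <;> ring
      -- The image stays within `2 * s` of a matched point of `f`, whereas `x` does not.
      · have := hx _ _ _ (hS z hz)
        intro heq
        simp only [Set.mem_singleton_iff] at heq
        rw [← heq, lt_abs] at this
        rcases hε with e | e <;> rw [e] at this <;> omega
    · intro z hz z' hz' heq
      simp only at heq
      have hb := hnear z hz
      have hb' := hnear z' hz'
      have hε := h.sign _ _ _ (hS z hz)
      have hε' := h.sign _ _ _ (hS z' hz')
      -- A common image is within `2 * s` of both `a z` and `a z'`, which are thus at most `4 * s ≤
      -- 2 * r` apart: both points were moved by the same map.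
      obtain ⟨h1, h2⟩ := h.compat _ _ _ _ _ _ (hS z hz) (hS z' hz') (by
        left
        rw [abs_le] at *
        rcases hε with e | e <;> rcases hε' with e' | e' <;> rw [e, e'] at heq <;> omega)
      rw [← h1] at heq
      rcases hε with e | e <;> rw [e] at heq h2 <;> omega
  omega

/-- Counts are required only for far points: a ball near an end of a word may stick out of it, and
then no factor describes it. -/
theorem IsMatching.exists_insert {B : Type*} {f g : ℤ → B} {r s t : ℕ}
    {S : Finset (ℤ × ℤ × ℤ)} (h : IsMatching f g r S) (hs : 3 * s ≤ r) {x : ℤ}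
    (hfin : (similarPoints f f s x).Finite)
    (hcount : (∀ a b ε, (a, b, ε) ∈ S → 2 * s < |x - a|) →
      min t (similarPoints f f s x).ncard = min t (similarPoints f g s x).ncard)
    (ht : S.card * (4 * s + 1) < t) :
    ∃ y ε, IsMatching f g s (insert (x, y, ε) S) := by
  by_cases hx : ∀ a b ε, (a, b, ε) ∈ S → 2 * s < |x - a|
  · obtain ⟨y, ⟨ε, hε, hd⟩, hy⟩ := h.exists_far_similarPoint hs hx hfin (hcount hx) ht
    exact ⟨y, ε, h.insert_of_far (by omega) hε hd hx hy⟩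
  · push Not at hx
    obtain ⟨a, b, ε, hp, hx⟩ := hx
    exact ⟨_, _, h.insert_of_near hs hp hx⟩

open FirstOrder FirstOrder.Language

/-! The back-and-forth argument. -/

/-- The numbers of occurrences of all words of odd length at most `2 * r + 1` agree up to
threshold `t`. -/
def CountsAgree {A : Type*} (w w' : List A) (r t : ℕ) : Prop :=
  ∀ s ≤ r, ∀ v : List A, v.length = 2 * s + 1 →
    min t (occurrences w v).ncard = min t (occurrences w' v).ncard

theorem CountsAgree.symm {A : Type*} {w w' : List A} {r t : ℕ} (h : CountsAgree w w' r t) :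
    CountsAgree w' w r t := fun s hs v hv => (h s hs v hv).symm

theorem CountsAgree.mono {A : Type*} {w w' : List A} {r s t : ℕ} (h : CountsAgree w w' r t)
    (hs : s ≤ r) : CountsAgree w w' s t := fun u hu => h u (hu.trans hs)

/-- The tuples `a` and `b` of positions, together with the end positions, are related by the
matching `S`. -/
structure GamePosition {A : Type*} (w w' : List A) (r : ℕ) (S : Finset (ℤ × ℤ × ℤ)) {n : ℕ}
    (a : Fin n → Fin w.length) (b : Fin n → Fin w'.length) : Prop where
  matching : IsMatching (letterAt w) (letterAt w') r S
  card_le : S.card ≤ n + 2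
  first : ∃ ε, ((0 : ℤ), (0 : ℤ), ε) ∈ S
  last : ∃ ε, ((w.length : ℤ) - 1, (w'.length : ℤ) - 1, ε) ∈ S
  tuple : ∀ i, ∃ ε, ((a i : ℤ), (b i : ℤ), ε) ∈ S

section

variable {A : Type*} {w w' : List A} {r s t n : ℕ} {S : Finset (ℤ × ℤ × ℤ)}
  {a : Fin n → Fin w.length} {b : Fin n → Fin w'.length}

theorem GamePosition.swap (h : GamePosition w w' r S a b) :
    GamePosition w' w r (swapTriples S) b a where
  matching := h.matching.swap
  card_le := Finset.card_image_le.trans h.card_le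
  first := by simpa only [mem_swapTriples] using h.first
  last := by simpa only [mem_swapTriples] using h.last
  tuple := by simpa only [mem_swapTriples] using h.tuple

theorem GamePosition.forth (h : GamePosition w w' r S a b) (hc : CountsAgree w w' r t)
    (hs : 3 * s ≤ r) (ht : (n + 2) * (4 * s + 1) < t) (x : Fin w.length) :
    ∃ y S', GamePosition w w' s S' (Fin.snoc a x : Fin (n + 1) → _) (Fin.snoc b y) := by
  have hxlt := x.isLt
  have hxw : letterAt w x ≠ none := by
    rw [Ne, letterAt_eq_none_iff]; omega
  obtain ⟨y, ε, hm⟩ := h.matching.exists_insert (t := t) hs (x := x)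
    (similarPoints_letterAt_finite w s hxw)
    (by
      -- Being far from both matched ends places the whole ball inside `w`.
      intro hfar
      obtain ⟨ε₀, h₀⟩ := h.first
      obtain ⟨ε₁, h₁⟩ := h.last
      have d₀ := hfar _ _ _ h₀
      have d₁ := hfar _ _ _ h₁
      rw [lt_abs] at d₀ d₁
      obtain ⟨v, hv, hcard⟩ := exists_factor_ncard_similarPoints w s (x := x) (by omega) (by omega)
      rw [hcard, hcard]
      exact hc s (by omega) v hv)
    (lt_of_le_of_lt (Nat.mul_le_mul_right _ h.card_le) ht)
  -- At the centre of the ball `y` carries the letter of `x`, so it is a position of `w'`.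
  have hy := hm.ball _ _ _ (Finset.mem_insert_self _ _) 0 (by simp)
  rw [mul_zero, add_zero, add_zero] at hy
  rw [hy, Ne, letterAt_eq_none_iff] at hxw
  refine ⟨⟨y.toNat, by omega⟩, _, hm, ?_, ?_, ?_, ?_⟩
  · have := Finset.card_insert_le ((x : ℤ), y, ε) S
    have := h.card_le
    omega
  · obtain ⟨ε₀, h₀⟩ := h.first
    exact ⟨ε₀, Finset.mem_insert_of_mem h₀⟩
  · obtain ⟨ε₁, h₁⟩ := h.last
    exact ⟨ε₁, Finset.mem_insert_of_mem h₁⟩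
  · intro i
    refine Fin.lastCases ?_ (fun i => ?_) i
    · refine ⟨ε, ?_⟩
      rw [Fin.snoc_last, Fin.snoc_last, Finset.mem_insert]
      left
      simp only [Prod.mk.injEq, true_and, and_true]
      omega
    · obtain ⟨δ, hδ⟩ := h.tuple i
      refine ⟨δ, ?_⟩
      rw [Fin.snoc_castSucc, Fin.snoc_castSucc]
      exact Finset.mem_insert_of_mem hδ

theorem GamePosition.back (h : GamePosition w w' r S a b) (hc : CountsAgree w w' r t)
    (hs : 3 * s ≤ r) (ht : (n + 2) * (4 * s + 1) < t) (y : Fin w'.length) :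
    ∃ x S', GamePosition w w' s S' (Fin.snoc a x : Fin (n + 1) → _) (Fin.snoc b y) := by
  obtain ⟨x, S', h'⟩ := h.swap.forth hc.symm hs ht y
  exact ⟨x, _, h'.swap⟩

end

/-- Satisfaction of a formula by a tuple of positions. -/
def RealizeIn {A : Type*} (w : List A) (hw : w ≠ []) {n : ℕ}
    (φ : (signature A).BoundedFormula Empty n) (a : Fin n → Fin w.length) : Prop :=
  letI := wordStructure w hw
  φ.Realize default a

/-- The position denoted by a term. -/
def termValue {A : Type*} (w : List A) (hw : w ≠ []) {n : ℕ} (a : Fin n → Fin w.length)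
    (τ : (signature A).Term (Empty ⊕ Fin n)) : Fin w.length :=
  letI := wordStructure w hw
  τ.realize (Sum.elim default a)

theorem GamePosition.termValue_mem {A : Type*} {w w' : List A} {r n : ℕ}
    {S : Finset (ℤ × ℤ × ℤ)} {a : Fin n → Fin w.length} {b : Fin n → Fin w'.length}
    (h : GamePosition w w' r S a b) (hw : w ≠ []) (hw' : w' ≠ [])
    (τ : (signature A).Term (Empty ⊕ Fin n)) :
    ∃ ε, ((termValue w hw a τ : ℤ), (termValue w' hw' b τ : ℤ), ε) ∈ S := by
  have hl := List.length_pos_of_ne_nil hw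
  have hl' := List.length_pos_of_ne_nil hw'
  cases τ with
  | var i =>
    rcases i with i | i
    · exact i.elim
    · exact h.tuple i
  | func f ts =>
    cases f with
    | minPos => exact h.first
    | maxPos =>
      convert h.last using 5
      · change ((w.length - 1 : ℕ) : ℤ) = _
        omega
      · change ((w'.length - 1 : ℕ) : ℤ) = _
        omega

/-- Claiming the equivalence for all larger radii and thresholds lets an implication take maxima of
the bounds for its two sides. -/
theorem realizeIn_congr {A : Type*} {n : ℕ} (φ : (signature A).BoundedFormula Empty n) :
    ∃ R T : ℕ, ∀ r ≥ R, ∀ t ≥ T, ∀ (w w' : List A) (hw : w ≠ []) (hw' : w' ≠ [])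
      (S : Finset (ℤ × ℤ × ℤ)) (a : Fin n → Fin w.length) (b : Fin n → Fin w'.length),
      CountsAgree w w' r t → GamePosition w w' r S a b →
        (RealizeIn w hw φ a ↔ RealizeIn w' hw' φ b) := by
  induction φ with
  | falsum => exact ⟨0, 0, fun _ _ _ _ _ _ _ _ _ _ _ _ _ => Iff.rfl⟩
  | equal τ₁ τ₂ =>
    refine ⟨0, 0, fun r _ _ _ w w' hw hw' S a b _ h => ?_⟩
    change termValue w hw a τ₁ = termValue w hw a τ₂ ↔
      termValue w' hw' b τ₁ = termValue w' hw' b τ₂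
    obtain ⟨ε₁, h₁⟩ := h.termValue_mem hw hw' τ₁
    obtain ⟨ε₂, h₂⟩ := h.termValue_mem hw hw' τ₂
    have hε := h.matching.sign _ _ _ h₁
    rw [Fin.ext_iff, Fin.ext_iff]
    constructor
    · intro e
      obtain ⟨-, h3⟩ := h.matching.compat _ _ _ _ _ _ h₁ h₂ (by left; rw [e]; simp)
      rcases hε with rfl | rfl <;> omega
    · intro e
      obtain ⟨-, h3⟩ := h.matching.compat _ _ _ _ _ _ h₁ h₂ (by right; rw [e]; simp)
      rcases hε with rfl | rfl <;> omega
  | rel R ts =>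
    -- Radius 1 makes the balls of neighbouring positions meet, so compatibility preserves their
    -- distance.
    refine ⟨1, 0, fun r hr _ _ w w' hw hw' S a b _ h => ?_⟩
    cases R with
    | letter c =>
      change w.get (termValue w hw a (ts 0)) = c ↔ w'.get (termValue w' hw' b (ts 0)) = c
      obtain ⟨ε, hε⟩ := h.termValue_mem hw hw' (ts 0)
      have := h.matching.ball _ _ _ hε 0 (by simp)
      rw [mul_zero, add_zero, add_zero, letterAt_natCast, letterAt_natCast,
        List.getElem?_eq_getElem (Fin.isLt _), List.getElem?_eq_getElem (Fin.isLt _),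
        Option.some_inj] at this
      rw [List.get_eq_getElem, List.get_eq_getElem, this]
    | neighbour =>
      change ((termValue w hw a (ts 0) : ℕ) + 1 = (termValue w hw a (ts 1) : ℕ) ∨
          (termValue w hw a (ts 1) : ℕ) + 1 = (termValue w hw a (ts 0) : ℕ)) ↔
        ((termValue w' hw' b (ts 0) : ℕ) + 1 = (termValue w' hw' b (ts 1) : ℕ) ∨
          (termValue w' hw' b (ts 1) : ℕ) + 1 = (termValue w' hw' b (ts 0) : ℕ))
      obtain ⟨ε₁, h₁⟩ := h.termValue_mem hw hw' (ts 0)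
      obtain ⟨ε₂, h₂⟩ := h.termValue_mem hw hw' (ts 1)
      have hε := h.matching.sign _ _ _ h₁
      constructor
      · intro e
        obtain ⟨-, h3⟩ := h.matching.compat _ _ _ _ _ _ h₁ h₂ (by left; rw [abs_le]; omega)
        rcases hε with rfl | rfl <;> omega
      · intro e
        obtain ⟨-, h3⟩ := h.matching.compat _ _ _ _ _ _ h₁ h₂ (by right; rw [abs_le]; omega)
        rcases hε with rfl | rfl <;> omega
  | imp φ ψ ihφ ihψ =>
    obtain ⟨R₁, T₁, h₁⟩ := ihφ
    obtain ⟨R₂, T₂, h₂⟩ := ihψ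
    refine ⟨max R₁ R₂, max T₁ T₂, fun r hr t ht w w' hw hw' S a b hc h => ?_⟩
    exact imp_congr
      (h₁ r (le_of_max_le_left hr) t (le_of_max_le_left ht) w w' hw hw' S a b hc h)
      (h₂ r (le_of_max_le_right hr) t (le_of_max_le_right ht) w w' hw hw' S a b hc h)
  | @all n φ ih =>
    obtain ⟨R, T, ih⟩ := ih
    -- One move costs a factor 3 in the radius; `n + 2` bounds the number of triples, the two ends
    -- included.
    refine ⟨3 * R, max T ((n + 2) * (4 * R + 1) + 1),
      fun r hr t ht w w' hw hw' S a b hc h => ?_⟩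
    have hR := ih R le_rfl t (le_of_max_le_left ht) w w' hw hw'
    have ht' : (n + 2) * (4 * R + 1) < t := le_of_max_le_right ht
    have hc' : CountsAgree w w' R t := hc.mono (by omega)
    change (∀ x, RealizeIn w hw φ (Fin.snoc a x)) ↔ ∀ y, RealizeIn w' hw' φ (Fin.snoc b y)
    constructor
    · intro H y
      obtain ⟨x, S', h'⟩ := h.back hc hr ht' y
      exact (hR S' _ _ hc' h').1 (H x)
    · intro H x
      obtain ⟨y, S', h'⟩ := h.forth hc hr ht' x
      exact (hR S' _ _ hc' h').2 (H y)

/-! ### From definability to testability. -/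

/-- The bound on `k` puts the two ends at least `2 * r + 1` apart in both words, so their balls do
not meet and the distance between them need not be preserved. Beyond an end both words read `none`.
-/
theorem gamePosition_ends {A : Type*} {w w' : List A} {k r : ℕ} (hk : 2 * r + 2 ≤ k)
    (hw : k ≤ w.length) (hw' : k ≤ w'.length) (hpre : w.take (k - 1) = w'.take (k - 1))
    (hsuf : w.rtake (k - 1) = w'.rtake (k - 1)) :
    GamePosition w w' r {(0, 0, 1), ((w.length : ℤ) - 1, (w'.length : ℤ) - 1, 1)}
      Fin.elim0 Fin.elim0 := by
  rw [List.rtake_eq_reverse_take_reverse, List.rtake_eq_reverse_take_reverse,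
    List.reverse_inj] at hsuf
  have hleft : ∀ d : ℤ, |d| ≤ r → letterAt w d = letterAt w' d := by
    intro d hd
    rw [abs_le] at hd
    rcases lt_or_ge d 0 with h | h
    · rw [letterAt_eq_none_iff.2 (Or.inl h), letterAt_eq_none_iff.2 (Or.inl h)]
    · lift d to ℕ using h
      rw [letterAt_natCast, letterAt_natCast,
        ← List.getElem?_take_of_lt (j := k - 1) (l := w) (by omega), hpre,
        List.getElem?_take_of_lt (by omega)]
  have hright : ∀ d : ℤ, |d| ≤ r →
      letterAt w ((w.length : ℤ) - 1 + d) = letterAt w' ((w'.length : ℤ) - 1 + d) := by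
    intro d hd
    rw [abs_le] at hd
    rcases lt_or_ge 0 d with h | h
    · rw [letterAt_eq_none_iff.2 (Or.inr (by omega)), letterAt_eq_none_iff.2 (Or.inr (by omega))]
    · obtain ⟨e, rfl⟩ : ∃ e : ℕ, d = -e := ⟨(-d).toNat, by omega⟩
      have hu : ∀ u : List A, k ≤ u.length →
          letterAt u ((u.length : ℤ) - 1 + -e) = (u.reverse.take (k - 1))[e]? := by
        intro u hu
        rw [List.getElem?_take_of_lt (by omega), List.getElem?_reverse (by omega),
          ← letterAt_natCast]
        congr 1; omega
      rw [hu w hw, hu w' hw', hsuf]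
  refine ⟨⟨?_, ?_, ?_⟩, Finset.card_le_two, ⟨1, by simp⟩, ⟨1, by simp⟩, fun i => i.elim0⟩
  · intro a b ε h
    simp only [Finset.mem_insert, Finset.mem_singleton, Prod.mk.injEq] at h
    omega
  · intro a b ε h d hd
    simp only [Finset.mem_insert, Finset.mem_singleton, Prod.mk.injEq] at h
    rcases h with ⟨rfl, rfl, rfl⟩ | ⟨rfl, rfl, rfl⟩
    · simpa using hleft d hd
    · simpa using hright d hd
  · intro a b ε a' b' ε' h h' hd
    simp only [Finset.mem_insert, Finset.mem_singleton, Prod.mk.injEq] at h h'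
    simp only [abs_le] at hd
    rcases h with ⟨rfl, rfl, rfl⟩ | ⟨rfl, rfl, rfl⟩ <;>
      rcases h' with ⟨rfl, rfl, rfl⟩ | ⟨rfl, rfl, rfl⟩ <;> omega

theorem RevEquiv.countsAgree {A : Type*} {w w' : List A} {k t r : ℕ} (hk : 2 * r + 1 ≤ k)
    (h : RevEquiv k t w w') : CountsAgree w w' r t := by
  rcases h with ⟨-, rfl⟩ | ⟨-, -, -, -, h⟩
  · exact fun _ _ _ _ => rfl
  · intro s hs v hv
    have hv' : v ≠ [] := by rintro rfl; simp at hv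
    rw [← revCount_eq_ncard_occurrences w hv', ← revCount_eq_ncard_occurrences w' hv',
      ← thresholdEq_iff]
    exact h v hv' (by omega)

theorem satisfies_congr_of_revEquiv {A : Type*} (φ : (signature A).Sentence) :
    ∃ k t : ℕ, 0 < k ∧ 0 < t ∧ ∀ w w' : List A, RevEquiv k t w w' →
      (w ∈ definedLanguage φ ↔ w' ∈ definedLanguage φ) := by
  obtain ⟨R, T, h⟩ := realizeIn_congr φ
  refine ⟨2 * R + 2, T + 1, by omega, by omega, fun w w' hww => ?_⟩
  have hd : ∀ (u : List A) (hu : u ≠ []), u ∈ definedLanguage φ ↔ RealizeIn u hu φ Fin.elim0 := by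
    intro u hu
    rw [Subsingleton.elim (Fin.elim0 : Fin 0 → Fin u.length) default]
    exact ⟨fun ⟨_, h⟩ => h, fun h => ⟨hu, h⟩⟩
  have hc := hww.countsAgree (r := R) (by omega)
  rcases hww with ⟨-, rfl⟩ | ⟨h1, h2, hpre, hsuf, -⟩
  · rfl
  · have hw : w ≠ [] := by rintro rfl; simp at h1
    have hw' : w' ≠ [] := by rintro rfl; simp at h2
    rw [hd w hw, hd w' hw']
    exact h R le_rfl (T + 1) (by omega) w w' hw hw' _ _ _ hc
      (gamePosition_ends le_rfl h1 h2 hpre hsuf)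

theorem isWeaklyLRTT_of_isDefinable {A : Type*} {L : Language A} (h : IsDefinable L) :
    IsWeaklyLRTT L := by
  obtain ⟨φ, hφ⟩ := h
  obtain ⟨k, t, hk, ht, hc⟩ := satisfies_congr_of_revEquiv φ
  refine ⟨k, t, hk, ht, {c | ∃ w ∈ L, c = {w' | RevEquiv k t w' w}}, ?_, ?_⟩
  · rintro c ⟨w, -, rfl⟩
    exact ⟨w, rfl⟩
  · ext w
    constructor
    · intro hw
      exact ⟨_, ⟨w, hw, rfl⟩, (revSetoid A k t).refl w⟩
    · rintro ⟨_, ⟨w', hw', rfl⟩, hww⟩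
      have hww : RevEquiv k t w w' := hww
      have hiff := hc w w' hww
      rw [hφ] at hiff
      -- The sentence says nothing about the empty word, but `0 < k` makes it alone in its class.
      by_cases h0 : w' = []
      · subst h0
        rcases hww with ⟨-, rfl⟩ | ⟨-, h2, -⟩
        · exact hw'
        · simp at h2; omega
      · exact (hiff.2 ⟨hw', h0⟩).1

/-! Uniformly definable predicates on tuples of positions. -/

/-- `P` is defined in all nonempty words by one first-order formula. -/
def UniformlyDefinable {A : Type*} {α : Type*}
    (P : ∀ w : List A, w ≠ [] → (α → Fin w.length) → Prop) : Prop :=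
  ∃ φ : (signature A).Formula α, ∀ (w : List A) (hw : w ≠ []) (x : α → Fin w.length),
    (letI := wordStructure w hw; φ.Realize x) ↔ P w hw x

/-- The nonempty words of `D` are those that satisfy some sentence. -/
def SententiallyDefinable {A : Type*} (D : Set (List A)) : Prop :=
  ∃ φ : (signature A).Sentence, ∀ (w : List A) (hw : w ≠ []), Satisfies w hw φ ↔ w ∈ D

namespace UniformlyDefinable

variable {A α : Type*} {P Q : ∀ w : List A, w ≠ [] → (α → Fin w.length) → Prop}

theorem const (p : Prop) : UniformlyDefinable (A := A) (α := α) fun _ _ _ => p := by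
  by_cases hp : p
  · exact ⟨⊤, fun w hw x => by
      let _ := wordStructure w hw
      simp [hp]⟩
  · exact ⟨⊥, fun w hw x => by
      let _ := wordStructure w hw
      simp [hp]⟩

theorem imp (hP : UniformlyDefinable P) (hQ : UniformlyDefinable Q) :
    UniformlyDefinable fun w hw x => P w hw x → Q w hw x := by
  obtain ⟨φ, hφ⟩ := hP
  obtain ⟨ψ, hψ⟩ := hQ
  exact ⟨φ.imp ψ, fun w hw x => imp_congr (hφ w hw x) (hψ w hw x)⟩

theorem not (hP : UniformlyDefinable P) : UniformlyDefinable fun w hw x => ¬ P w hw x :=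
  hP.imp (const False)

theorem forall_finite {β : Type*} [Finite β]
    {P : β → ∀ w : List A, w ≠ [] → (α → Fin w.length) → Prop}
    (hP : ∀ b, UniformlyDefinable (P b)) :
    UniformlyDefinable fun w hw x => ∀ b, P b w hw x := by
  choose φ hφ using hP
  refine ⟨Formula.iInf φ, fun w hw x => ?_⟩
  let _ := wordStructure w hw
  rw [Formula.realize_iInf]
  exact forall_congr' fun b => hφ b w hw x

theorem exists_finite {β : Type*} [Finite β]
    {P : β → ∀ w : List A, w ≠ [] → (α → Fin w.length) → Prop}
    (hP : ∀ b, UniformlyDefinable (P b)) :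
    UniformlyDefinable fun w hw x => ∃ b, P b w hw x := by
  simpa only [not_forall, not_not] using (forall_finite fun b => (hP b).not).not

theorem and (hP : UniformlyDefinable P) (hQ : UniformlyDefinable Q) :
    UniformlyDefinable fun w hw x => P w hw x ∧ Q w hw x := by
  simpa only [Classical.not_imp, not_not] using (hP.imp hQ.not).not

theorem eq (i j : α) : UniformlyDefinable (A := A) fun _ _ x => x i = x j :=
  ⟨Term.equal (Term.var i) (Term.var j), fun w hw x => by
    let _ := wordStructure w hw
    exact Formula.realize_equal⟩

theorem eq_first (i : α) : UniformlyDefinable (A := A) fun _ _ x => (x i : ℕ) = 0 := by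
  refine ⟨Term.equal (Term.var i) (Term.func (L := signature A) (l := 0) ConstSymb.minPos
    Fin.elim0), fun w hw x => ?_⟩
  let _ := wordStructure w hw
  exact Formula.realize_equal.trans Fin.ext_iff

theorem eq_last (i : α) :
    UniformlyDefinable (A := A) fun w _ x => (x i : ℕ) = w.length - 1 := by
  refine ⟨Term.equal (Term.var i) (Term.func (L := signature A) (l := 0) ConstSymb.maxPos
    Fin.elim0), fun w hw x => ?_⟩
  let _ := wordStructure w hw
  exact Formula.realize_equal.trans Fin.ext_iff

theorem letter (c : A) (i : α) : UniformlyDefinable (A := A) fun w _ x => w.get (x i) = c := by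
  refine ⟨Relations.formula (L := signature A) (n := 1) (RelSymb.letter c)
    fun _ => Term.var i, fun w hw x => ?_⟩
  let _ := wordStructure w hw
  exact Formula.realize_rel

theorem neighbour (i j : α) : UniformlyDefinable (A := A)
    fun _ _ x => (x i : ℕ) + 1 = x j ∨ (x j : ℕ) + 1 = x i := by
  refine ⟨Relations.formula (L := signature A) (n := 2) RelSymb.neighbour
    ![Term.var i, Term.var j], fun w hw x => ?_⟩
  let _ := wordStructure w hw
  exact Formula.realize_rel

theorem sententiallyDefinable_exists [Finite α] (hP : UniformlyDefinable P) :
    SententiallyDefinable {w | ∃ (hw : w ≠ []) (x : α → Fin w.length), P w hw x} := by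
  obtain ⟨φ, hφ⟩ := hP
  refine ⟨Formula.iExs α (φ.relabel (Sum.inr : α → Empty ⊕ α)), fun w hw => ?_⟩
  let _ := wordStructure w hw
  refine Formula.realize_iExs.trans ?_
  simp only [Formula.realize_relabel, Sum.elim_comp_inr]
  exact ⟨fun ⟨x, hx⟩ => ⟨hw, x, (hφ w hw x).1 hx⟩, fun ⟨_, x, hx⟩ => ⟨x, (hφ w hw x).2 hx⟩⟩

end UniformlyDefinable

theorem sententiallyDefinable_iff {A : Type*} {D : Set (List A)} :
    SententiallyDefinable D ↔
      UniformlyDefinable (A := A) (α := Empty) fun w _ _ => w ∈ D :=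
  ⟨fun ⟨φ, h⟩ => ⟨φ, fun w hw x => by
      rw [Subsingleton.elim x default]; exact h w hw⟩,
    fun ⟨φ, h⟩ => ⟨φ, fun w hw => h w hw default⟩⟩

theorem SententiallyDefinable.isDefinable {A : Type*} {L : Language A}
    (h : SententiallyDefinable {w | w ∈ L}) : IsDefinable L := by
  obtain ⟨φ, h⟩ := h
  refine ⟨φ, ?_⟩
  ext w
  exact ⟨fun ⟨hw, hs⟩ => ⟨(h w hw).1 hs, hw⟩, fun ⟨hL, hw⟩ => ⟨hw, (h w hw).2 hL⟩⟩

/-- On nonempty words `K` is the disjunction of the membership patterns realised by its nonempty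
members, and a finite family has finitely many patterns. -/
theorem SententiallyDefinable.of_determined {A ι : Type*} [Finite ι] {D : ι → Set (List A)}
    (hD : ∀ i, SententiallyDefinable (D i)) {K : Set (List A)}
    (hK : ∀ w w' : List A, w ≠ [] → w' ≠ [] → (∀ i, w ∈ D i ↔ w' ∈ D i) → (w ∈ K ↔ w' ∈ K)) :
    SententiallyDefinable K := by
  simp only [sententiallyDefinable_iff] at hD ⊢
  have key : UniformlyDefinable (A := A) (α := Empty) fun w _ _ =>
      ∃ p : {p : ι → Prop // ∃ w' ∈ K, w' ≠ [] ∧ p = fun i => w' ∈ D i},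
        ∀ i, (w ∈ D i → p.1 i) ∧ (p.1 i → w ∈ D i) :=
    .exists_finite fun p => .forall_finite fun i =>
      ((hD i).imp (.const _)).and ((UniformlyDefinable.const _).imp (hD i))
  obtain ⟨φ, hφ⟩ := key
  refine ⟨φ, fun w hw x => (hφ w hw x).trans ⟨?_, fun h => ?_⟩⟩
  · rintro ⟨⟨p, w', hw', h0, rfl⟩, h⟩
    exact (hK w w' hw h0 fun i => ⟨(h i).1, (h i).2⟩).2 hw'
  · exact ⟨⟨_, w, h, hw, rfl⟩, fun i => ⟨id, id⟩⟩

/-! Walks in a word. -/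

/-- A walk by unit steps that reversed direction would return to the position it held two steps
earlier. -/
theorem eq_add_or_add_eq_of_injOn {x : ℕ → ℕ} {n : ℕ} (hinj : Set.InjOn x (Set.Iio n))
    (hadj : ∀ i, i + 1 < n → x i + 1 = x (i + 1) ∨ x (i + 1) + 1 = x i) :
    (∀ i < n, x i = x 0 + i) ∨ ∀ i < n, x i + i = x 0 := by
  induction n with
  | zero => left; intro i hi; omega
  | succ n ih =>
    have ih := ih (hinj.mono fun i (hi : i < n) => show i < n + 1 by omega)
      fun i hi => hadj i (by omega)
    rcases n with _ | _ | n
    · left; intro i hi; obtain rfl : i = 0 := by omega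
      rfl
    · rcases hadj 0 (by omega) with h | h
      · left; intro i hi
        obtain rfl | rfl : i = 0 ∨ i = 1 := by omega
        · rfl
        · exact h.symm
      · right; intro i hi
        obtain rfl | rfl : i = 0 ∨ i = 1 := by omega
        · rfl
        · exact h
    · have hne : x n ≠ x (n + 2) := fun h => by
        have := hinj (show n < n + 2 + 1 by omega) (show n + 2 < n + 2 + 1 by omega) h
        omega
      have h2 := hadj (n + 1) (by omega)
      rw [show n + 1 + 1 = n + 2 from rfl] at h2
      rcases ih with ih | ih
      · left; intro i hi
        have h0 := ih n (by omega)
        have h1 := ih (n + 1) (by omega)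
        rcases Nat.lt_succ_iff_lt_or_eq.1 hi with hi | rfl
        · exact ih i hi
        · change x (n + 2) = x 0 + (n + 2)
          omega
      · right; intro i hi
        have h0 := ih n (by omega)
        have h1 := ih (n + 1) (by omega)
        rcases Nat.lt_succ_iff_lt_or_eq.1 hi with hi | rfl
        · exact ih i hi
        · change x (n + 2) + (n + 2) = x 0
          omega

/-- The positions `x i` are distinct, each is a neighbour of the next, and they carry the
letters of `v`. -/
def ReadsAlong {A : Type*} (w v : List A) (x : Fin v.length → Fin w.length) : Prop :=
  (∀ i j, x i = x j → i = j) ∧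
  (∀ i j : Fin v.length, (i : ℕ) + 1 = j → (x i : ℕ) + 1 = x j ∨ (x j : ℕ) + 1 = x i) ∧
  ∀ i, w.get (x i) = v.get i

theorem uniformlyDefinable_readsAlong {A α : Type*} (v : List A) (e : Fin v.length → α) :
    UniformlyDefinable (A := A) (α := α) fun w _ x => ReadsAlong w v fun i => x (e i) :=
  .and (.forall_finite fun _ => .forall_finite fun _ => (UniformlyDefinable.eq _ _).imp (.const _))
    (.and (.forall_finite fun _ => .forall_finite fun _ =>
      (UniformlyDefinable.const _).imp (.neighbour _ _))
      (.forall_finite fun _ => .letter _ _))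

theorem ReadsAlong.straight {A : Type*} {w v : List A} {x : Fin v.length → Fin w.length}
    (h : ReadsAlong w v x) (hv : 0 < v.length) :
    (∀ i, (x i : ℕ) = x ⟨0, hv⟩ + i) ∨ ∀ i, (x i : ℕ) + i = x ⟨0, hv⟩ := by
  obtain ⟨hinj, hadj, -⟩ := h
  have key := eq_add_or_add_eq_of_injOn (n := v.length)
    (x := fun i => if hi : i < v.length then (x ⟨i, hi⟩ : ℕ) else 0) (by
      intro i (hi : i < _) j (hj : j < _) hij
      simp only [hi, hj, dif_pos] at hij
      simpa using hinj _ _ (Fin.ext hij)) (by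
      intro i hi
      simp only [hi, show i < v.length by omega, dif_pos]
      exact hadj ⟨i, _⟩ ⟨i + 1, hi⟩ rfl)
  simp only [hv, dif_pos] at key
  refine key.imp (fun h i => ?_) (fun h i => ?_)
  · simpa using h i i.isLt
  · simpa using h i i.isLt

theorem ReadsAlong.of_occursAt {A : Type*} {w v : List A} {m : ℕ} (h : OccursAt w v m)
    (hm : m + v.length ≤ w.length) :
    ReadsAlong w v fun i => ⟨m + i, by omega⟩ := by
  refine ⟨fun i j hij => ?_, fun i j hij => ?_, fun i => ?_⟩
  · simp only [Fin.mk.injEq] at hij; omega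
  · simp only; omega
  · have := h i i.isLt
    rw [List.getElem?_eq_getElem (by omega), List.getElem?_eq_getElem i.isLt] at this
    simpa using this

theorem ReadsAlong.of_occursAt_reverse {A : Type*} {w v : List A} {m : ℕ}
    (h : OccursAt w v.reverse m) (hm : m + v.length ≤ w.length) :
    ReadsAlong w v fun i => ⟨m + (v.length - 1 - i), by omega⟩ := by
  refine ⟨fun i j hij => ?_, fun i j hij => ?_, fun i => ?_⟩
  · simp only [Fin.mk.injEq] at hij; omega
  · simp only; omega
  · have := h (v.length - 1 - i) (by rw [List.length_reverse]; omega)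
    rw [List.getElem?_eq_getElem (by omega), List.getElem?_reverse (by omega),
      List.getElem?_eq_getElem (by omega), Option.some_inj] at this
    simp only [List.get_eq_getElem, this]
    congr 1; omega

theorem ReadsAlong.occursAt {A : Type*} {w v : List A} {x : Fin v.length → Fin w.length}
    (h : ReadsAlong w v x) {m : ℕ} (hx : ∀ i, (x i : ℕ) = m + i) : OccursAt w v m := by
  intro j hj
  have := h.2.2 ⟨j, hj⟩
  rw [List.getElem?_eq_getElem hj, ← hx ⟨j, hj⟩, List.getElem?_eq_getElem (x ⟨j, hj⟩).isLt]
  simpa using this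

theorem ReadsAlong.occursAt_reverse {A : Type*} {w v : List A} {x : Fin v.length → Fin w.length}
    (h : ReadsAlong w v x) {m : ℕ} (hx : ∀ i, (x i : ℕ) + i + 1 = m + v.length) :
    OccursAt w v.reverse m := by
  intro j hj
  rw [List.length_reverse] at hj
  have := h.2.2 ⟨v.length - 1 - j, by omega⟩
  have hx := hx ⟨v.length - 1 - j, by omega⟩
  simp only [List.get_eq_getElem] at this hx
  rw [List.getElem?_reverse hj, List.getElem?_eq_getElem (l := v) (by omega), ← this,
    show m + j = x ⟨v.length - 1 - j, by omega⟩ by omega, List.getElem?_eq_getElem]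

/-- The set of visited positions is an interval that determines `m` whichever way `v` is read. -/
theorem mem_occurrences_iff_exists_readsAlong {A : Type*} {w v : List A} {m : ℕ} (hv : v ≠ []) :
    m ∈ occurrences w v ↔ ∃ x, ReadsAlong w v x ∧
      ∀ p : ℕ, (∃ i, (x i : ℕ) = p) ↔ m ≤ p ∧ p < m + v.length := by
  have hl := List.length_pos_of_ne_nil hv
  constructor
  · rintro (h | h)
    · refine ⟨_, .of_occursAt h (h.add_length_le hv), fun p => ⟨?_, fun hp => ?_⟩⟩
      · rintro ⟨i, rfl⟩; simp
      · exact ⟨⟨p - m, by omega⟩, by simp only; omega⟩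
    · have hm := h.add_length_le (by simpa using hv)
      rw [List.length_reverse] at hm
      refine ⟨_, .of_occursAt_reverse h hm, fun p => ⟨?_, fun hp => ?_⟩⟩
      · rintro ⟨i, rfl⟩; simp only; omega
      · exact ⟨⟨m + v.length - 1 - p, by omega⟩, by simp only; omega⟩
  · rintro ⟨x, h, hp⟩
    rcases h.straight hl with hx | hx
    · left
      obtain ⟨i, hi⟩ := (hp m).2 ⟨le_rfl, by omega⟩
      have h0 := (hp (x ⟨0, hl⟩)).1 ⟨_, rfl⟩
      have := hx i
      exact h.occursAt (m := m) fun i => by have := hx i; omega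
    · right
      obtain ⟨i, hi⟩ := (hp (m + v.length - 1)).2 ⟨by omega, by omega⟩
      have h0 := (hp (x ⟨0, hl⟩)).1 ⟨_, rfl⟩
      have := hx i
      exact h.occursAt_reverse fun i => by have := hx i; omega

theorem ReadsAlong.exists_interval {A : Type*} {w v : List A} {x : Fin v.length → Fin w.length}
    (h : ReadsAlong w v x) (hv : v ≠ []) :
    ∃ m, ∀ p : ℕ, (∃ i, (x i : ℕ) = p) ↔ m ≤ p ∧ p < m + v.length := by
  have hl := List.length_pos_of_ne_nil hv
  rcases h.straight hl with hx | hx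
  · refine ⟨x ⟨0, hl⟩, fun p => ⟨?_, fun hp => ⟨⟨p - x ⟨0, hl⟩, by omega⟩, ?_⟩⟩⟩
    · rintro ⟨i, rfl⟩; have := hx i; omega
    · rw [hx]; simp only; omega
  · have hlast := hx ⟨v.length - 1, by omega⟩
    simp only at hlast
    refine ⟨x ⟨v.length - 1, by omega⟩, fun p => ⟨?_, fun hp => ⟨⟨x ⟨0, hl⟩ - p, by omega⟩, ?_⟩⟩⟩
    · rintro ⟨i, rfl⟩; have := hx i; omega
    · have := hx ⟨x ⟨0, hl⟩ - p, by omega⟩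
      simp only at this
      omega

/-- Occurrences are told apart by the sets they visit, not by the tuples: a palindrome is read in
two ways over one interval. Inclusion suffices, as the intervals have equal length. -/
theorem le_ncard_occurrences_iff {A : Type*} {w v : List A} (hv : v ≠ []) (s : ℕ) :
    s ≤ (occurrences w v).ncard ↔ ∃ x : Fin s × Fin v.length → Fin w.length,
      (∀ i, ReadsAlong w v fun c => x (i, c)) ∧
      ∀ i j, (∀ c, ∃ c', x (i, c) = x (j, c')) → i = j := by
  have := (occurrences_finite w hv).to_subtype
  have hl := List.length_pos_of_ne_nil hv
  rw [← Nat.card_coe_set_eq]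
  constructor
  · intro hs
    let m : Fin s → occurrences w v := fun i => (Finite.equivFin _).symm (Fin.castLE hs i)
    have hm : Function.Injective m :=
      (Equiv.injective _).comp (Fin.castLE_injective hs)
    choose x hx hint using fun i =>
      (mem_occurrences_iff_exists_readsAlong hv).1 (m i).2
    refine ⟨fun p => x p.1 p.2, hx, fun i j hij => hm (Subtype.ext ?_)⟩
    have hsub : ∀ p : ℕ, m i ≤ p ∧ p < m i + v.length → m j ≤ p ∧ p < m j + v.length := by
      intro p hp
      obtain ⟨c, rfl⟩ := (hint i p).2 hp
      obtain ⟨c', hc'⟩ := hij c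
      exact (hint j _).1 ⟨c', by simp only at hc'; rw [hc']⟩
    have h1 := hsub (m i) (by omega)
    have h2 := hsub (m i + v.length - 1) (by omega)
    omega
  · rintro ⟨x, hx, hd⟩
    choose m hm using fun i => (hx i).exists_interval hv
    have hmem : ∀ i, m i ∈ occurrences w v := fun i =>
      (mem_occurrences_iff_exists_readsAlong hv).2 ⟨_, hx i, hm i⟩
    have hinj : Function.Injective fun i => (⟨m i, hmem i⟩ : occurrences w v) := by
      intro i j hij
      simp only [Subtype.mk.injEq] at hij
      refine hd i j fun c => ?_
      have := (hm i (x (i, c))).1 ⟨c, rfl⟩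
      rw [hij] at this
      obtain ⟨c', hc'⟩ := (hm j _).2 this
      exact ⟨c', Fin.ext hc'.symm⟩
    simpa using Nat.card_le_card_of_injective _ hinj

/-! Definability of the properties that determine the equivalence class. -/

theorem sententiallyDefinable_le_revCount {A : Type*} {v : List A} (hv : v ≠ []) (s : ℕ) :
    SententiallyDefinable {w | s ≤ revCount w v} := by
  obtain ⟨φ, hφ⟩ := UniformlyDefinable.sententiallyDefinable_exists
    (UniformlyDefinable.and
      (.forall_finite fun i : Fin s => uniformlyDefinable_readsAlong v fun c => (i, c))
      (.forall_finite fun i : Fin s => .forall_finite fun j : Fin s =>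
        (UniformlyDefinable.forall_finite fun c : Fin v.length =>
          .exists_finite fun c' : Fin v.length => .eq (i, c) (j, c')).imp (.const (i = j))))
  refine ⟨φ, fun w hw => (hφ w hw).trans ?_⟩
  rw [Set.mem_ofPred_eq, Set.mem_ofPred_eq, revCount_eq_ncard_occurrences w hv,
    le_ncard_occurrences_iff hv]
  exact ⟨fun ⟨_, h⟩ => h, fun h => ⟨hw, h⟩⟩

theorem sententiallyDefinable_le_length {A : Type*} (s : ℕ) :
    SententiallyDefinable {w : List A | s ≤ w.length} := by
  obtain ⟨φ, hφ⟩ := UniformlyDefinable.sententiallyDefinable_exists (A := A)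
    (.forall_finite fun i : Fin s => .forall_finite fun j : Fin s =>
      (UniformlyDefinable.eq i j).imp (.const (i = j)))
  refine ⟨φ, fun w hw => (hφ w hw).trans ⟨?_, fun h => ⟨hw, Fin.castLE h, ?_⟩⟩⟩
  · rintro ⟨_, x, hx⟩
    simpa using Fintype.card_le_of_injective x fun i j => hx i j
  · exact fun i j hij => Fin.castLE_injective h hij

theorem occursAt_zero_iff_prefix {A : Type*} {w v : List A} : OccursAt w v 0 ↔ v <+: w := by
  rw [List.prefix_iff_getElem?]
  refine forall_congr' fun i => forall_congr' fun hi => ?_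
  rw [zero_add, List.getElem?_eq_getElem hi]

/-- A straight walk that starts at the first position can only ascend. -/
theorem sententiallyDefinable_prefix {A : Type*} (v : List A) :
    SententiallyDefinable {w | v <+: w} := by
  obtain ⟨φ, hφ⟩ := UniformlyDefinable.sententiallyDefinable_exists
    ((uniformlyDefinable_readsAlong v id).and
      (.forall_finite fun i : Fin v.length =>
        (UniformlyDefinable.const ((i : ℕ) = 0)).imp (.eq_first i)))
  refine ⟨φ, fun w hw => (hφ w hw).trans ⟨?_, fun h => ⟨hw, ?_⟩⟩⟩
  · rintro ⟨_, x, hx, h0⟩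
    rcases Nat.eq_zero_or_pos v.length with hv | hv
    · rw [List.length_eq_zero_iff] at hv
      simp [hv]
    · have h0 := h0 ⟨0, hv⟩ rfl
      refine occursAt_zero_iff_prefix.1 (hx.occursAt fun i => ?_)
      simp only [id]
      rcases hx.straight hv with hs | hs <;> have := hs i <;> simp only [id] at this <;> omega
  · exact ⟨fun i => ⟨0 + i, by have := h.length_le; omega⟩,
      .of_occursAt (occursAt_zero_iff_prefix.2 h) (by simpa using h.length_le),
      fun i hi => by simpa using hi⟩

theorem sententiallyDefinable_suffix {A : Type*} (v : List A) :
    SententiallyDefinable {w | v <:+ w} := by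
  obtain ⟨φ, hφ⟩ := UniformlyDefinable.sententiallyDefinable_exists
    ((uniformlyDefinable_readsAlong v id).and
      (.forall_finite fun i : Fin v.length =>
        (UniformlyDefinable.const ((i : ℕ) + 1 = v.length)).imp (.eq_last i)))
  refine ⟨φ, fun w hw => (hφ w hw).trans ⟨?_, ?_⟩⟩
  · rintro ⟨_, x, hx, hlast⟩
    rcases Nat.eq_zero_or_pos v.length with hv | hv
    · rw [List.length_eq_zero_iff] at hv
      simp [hv]
    · have hlast := hlast ⟨v.length - 1, by omega⟩ (by simp only; omega)
      have hstraight := hx.straight hv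
      simp only [id] at hstraight
      have h0 := (x ⟨0, hv⟩).isLt
      -- A walk that ends at the last position cannot have descended to it, unless it has length 1.
      have hup : ∀ i, (x i : ℕ) = w.length - v.length + i := by
        intro i
        rcases hstraight with hs | hs <;> have h1 := hs i <;>
          have h2 := hs ⟨v.length - 1, by omega⟩ <;> simp only at h2 <;> omega
      obtain ⟨y, z, hyz, hy⟩ :=
        (occursAt_iff_exists_append (List.ne_nil_of_length_pos hv)).1 (hx.occursAt hup)
      have hlen := congrArg List.length hyz
      simp only [List.length_append] at hlen
      have hle := hup ⟨v.length - 1, by omega⟩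
      simp only at hle
      have hz : z = [] := List.length_eq_zero_iff.1 (by omega)
      exact ⟨y, by rw [hyz, hz, List.append_nil]⟩
  · rintro ⟨u, rfl⟩
    have hocc : OccursAt (u ++ v) v u.length := by
      intro j _
      rw [List.getElem?_append_right (by omega), Nat.add_sub_cancel_left]
    exact ⟨hw, fun i => ⟨u.length + i, by rw [List.length_append]; omega⟩,
      .of_occursAt hocc (by simp), fun i hi => by simp only [List.length_append]; omega⟩

/-! ### From testability to definability. -/

theorem sententiallyDefinable_of_revEquiv {A : Type*} [Finite A] {k t : ℕ} {K : Set (List A)}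
    (hK : ∀ w w', RevEquiv k t w w' → (w ∈ K ↔ w' ∈ K)) : SententiallyDefinable K := by
  have hfin : Finite {v : List A // v.length ≤ k} := (List.finite_length_le A k).to_subtype
  let D : Fin (k + 1) ⊕ {v : List A // v.length ≤ k} ⊕ {v : List A // v.length ≤ k} ⊕
      {v : List A // v.length ≤ k} × Fin (t + 1) → Set (List A) :=
    Sum.elim (fun s => {w | s ≤ w.length}) <| Sum.elim (fun v => {w | v.1 <+: w}) <|
      Sum.elim (fun v => {w | v.1 <:+ w}) fun p => {w | p.1.1 ≠ [] → p.2 ≤ revCount w p.1.1}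
  refine SententiallyDefinable.of_determined (D := D) ?_ ?_
  · rintro (s | v | v | ⟨v, s⟩)
    · exact sententiallyDefinable_le_length s
    · exact sententiallyDefinable_prefix v.1
    · exact sententiallyDefinable_suffix v.1
    · by_cases hv : v.1 = []
      · exact ⟨⊤, fun w hw => by simp [D, hv, Satisfies, Sentence.Realize]⟩
      · have := sententiallyDefinable_le_revCount hv s
        simpa [D, hv] using this
  · intro w w' _ _ h
    refine hK w w' ?_
    have hlen : ∀ s ≤ k, s ≤ w.length ↔ s ≤ w'.length := fun s hs =>
      h (Sum.inl ⟨s, by omega⟩)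
    have hpre : ∀ v : List A, v.length ≤ k → (v <+: w ↔ v <+: w') := fun v hv =>
      h (Sum.inr (Sum.inl ⟨v, hv⟩))
    have hsuf : ∀ v : List A, v.length ≤ k → (v <:+ w ↔ v <:+ w') := fun v hv =>
      h (Sum.inr (Sum.inr (Sum.inl ⟨v, hv⟩)))
    have hcount : ∀ v : List A, v ≠ [] → v.length ≤ k → ∀ s ≤ t,
        s ≤ revCount w v ↔ s ≤ revCount w' v := by
      intro v hv hvk s hs
      have : (v ≠ [] → s ≤ revCount w v) ↔ (v ≠ [] → s ≤ revCount w' v) :=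
        h (Sum.inr (Sum.inr (Sum.inr (⟨v, hvk⟩, ⟨s, by omega⟩))))
      simpa [hv] using this
    rcases lt_or_ge w.length k with hw | hw
    -- A word shorter than `k` is itself one of the tested prefixes, and the length test at
    -- `w.length + 1` rules out a longer `w'`.
    · have h1 : w <+: w' := (hpre w hw.le).1 (List.prefix_refl w)
      have h2 := hlen (w.length + 1) hw
      exact Or.inl ⟨hw, h1.eq_of_length_le (by omega)⟩
    · have hw' := (hlen k le_rfl).1 hw
      refine Or.inr ⟨hw, hw', ?_, ?_, fun v hv hvk => ?_⟩
      · have := (hpre (w.take (k - 1)) (by rw [List.length_take]; omega)).1 (List.take_prefix _ _)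
        rw [List.prefix_iff_eq_take] at this
        rw [this, List.length_take, min_eq_left (by omega)]
      · have := (hsuf (w.rtake (k - 1)) (by rw [List.rtake, List.length_drop]; omega)).1
          (List.drop_suffix _ _)
        rw [List.suffix_iff_eq_drop] at this
        rw [this, List.rtake, List.rtake, List.length_drop]
        congr 1
        omega
      · rw [thresholdEq_iff]
        -- Testing at the truncated counts themselves bounds each by the other.
        have h1 := hcount v hv hvk (min t (revCount w v)) (min_le_left _ _)
        have h2 := hcount v hv hvk (min t (revCount w' v)) (min_le_left _ _)
        omega

theorem isDefinable_of_isWeaklyLRTT {A : Type*} [Finite A] {L : Language A}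
    (h : IsWeaklyLRTT L) : IsDefinable L := by
  obtain ⟨k, t, -, -, C, hC, hL⟩ := h
  refine (sententiallyDefinable_of_revEquiv (k := k) (t := t) fun w w' hww => ?_).isDefinable
  rw [hL]
  have key : ∀ u u' : List A, RevEquiv k t u u' → u ∈ ⋃₀ C → u' ∈ ⋃₀ C := by
    rintro u u' huu ⟨c, hc, hu⟩
    obtain ⟨z, rfl⟩ := hC hc
    exact ⟨_, hc, (revSetoid A k t).trans ((revSetoid A k t).symm huu) hu⟩
  exact ⟨key w w' hww, key w' w ((revSetoid A k t).symm hww)⟩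

end NeighbourLogic

theorem mainTheorem2 {A : Type*} [Finite A] (L : Language A) :
    NeighbourLogic.IsDefinable L ↔ NeighbourLogic.IsWeaklyLRTT L :=
  ⟨NeighbourLogic.isWeaklyLRTT_of_isDefinable, NeighbourLogic.isDefinable_of_isWeaklyLRTT⟩
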